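/- Identify the quaternions $\mathbf H$ with $\mathbf C^2$ by $z_1+jz_2\leftrightarrow\binom{z_1}{z_2}$, so that the product is $$\binom{z_1}{z_2}\cdot\binom{w_1}{w_2}=\binom{z_1w_1-\overline z_2w_2}{\overline z_1w_2+z_2w_1},$$ and let $\mathbf C$ act on $\mathbf H$ by scalar multiplication on $\mathbf C^2$. Let $S^3=\{|z|=1\}\subset\mathbf C^2$ and let $S^3\mathbf H$ be the associative real algebra of smooth maps $S^3\to\mathbf H$ with pointwise product. Put $$e_-=-\overline z_2\frac{\partial}{\partial z_1}+\overline z_1\frac{\partial}{\partial z_2},\qquad \hat e_-=\overline z_2\frac{\partial}{\partial\overline z_1}-z_1\frac{\partial}{\partial z_2},\qquad v^k_{(a,b)}=(e_-)^k z_1^az_2^b,\qquad w^k_{(a,b)}=(\hat e_-)^k z_2^a\overline z_1^{\,b},$$ and, for integers $m\ge 0$, $0\le l\le m$, $0\le k\le m+1$, $$\phi^{+(m,l,k)}=\sqrt{\tfrac{(m+1-k)!}{k!\,l!\,(m-l)!}}\binom{k\,v^{k-1}_{(l,m-l)}}{-v^k_{(l,m-l)}},\qquad \phi^{-(m,l,k)}=\sqrt{\tfrac{(m+1-k)!}{k!\,l!\,(m-l)!}}\;\frac{1}{|z|^{2(m+2)}}\binom{w^k_{(m+1-l,l)}}{w^k_{(m-l,l+1)}}$$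 (the first component of $\phi^{+(m,l,0)}$ is $0$). Let $\mathbf C[\phi^\pm]$ be the space of finite $\mathbf C$-linear combinations of the spinors $\phi^{\pm(m,l,k)}$ on $\mathbf C^2\setminus\{0\}$, and let $\mathbf C[\phi^\pm]|_{S^3}$ be the space of their restrictions to $S^3$. Then $\mathbf C[\phi^\pm]|_{S^3}$ is closed under pointwise quaternion multiplication, and it is an associative (real) subalgebra of $S^3\mathbf H$. On $S^3$ one has $$I:=\phi^{+(0,0,1)}=\binom10,\quad J:=\phi^{+(0,0,0)}=\binom0{-1},\quad \kappa:=\phi^{+(1,0,1)}=\binom{z_2}{-\overline z_1},\quad \mu:=\phi^{-(0,0,0)}=\binom{z_2}{\overline z_1},$$ and $\mathbf C[\phi^\pm]|_{S^3}$ is generated by $I,J,\kappa,\mu$: it is exactly the set of finite $\mathbf C$-linear combinations of finite products of $I,J,\kappa,\mu$ (restricted to $S^3$). -/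

import Mathlib

open scoped Manifold ContDiff ComplexConjugate

noncomputable section

/-! ### The quaternions as pairs of complex numbers -/

/-- The quaternions `z₁ + j z₂`, written as pairs `(z₁, z₂)` of complex numbers. The complex vector
space structure is that of `ℂ × ℂ`; the multiplication is the quaternion product (see `Quat.mul_def`
and the comparison `Quat.toQuaternion` with Mathlib's quaternions), not the componentwise one. -/
def Quat : Type := ℂ × ℂ

namespace Quat

instance : AddCommGroup Quat := inferInstanceAs (AddCommGroup (ℂ × ℂ))

instance : Module ℂ Quat := inferInstanceAs (Module ℂ (ℂ × ℂ))

/-- The quaternion `a + j b`. -/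
def mk (a b : ℂ) : Quat := (a, b)

/-- The first complex component. -/
def fst (x : Quat) : ℂ := Prod.fst x

/-- The second complex component. -/
def snd (x : Quat) : ℂ := Prod.snd x

@[ext] theorem ext {x y : Quat} (h₁ : x.fst = y.fst) (h₂ : x.snd = y.snd) : x = y :=
  Prod.ext h₁ h₂

@[simp] theorem fst_mk (a b : ℂ) : (mk a b).fst = a := rfl
@[simp] theorem snd_mk (a b : ℂ) : (mk a b).snd = b := rfl
@[simp] theorem fst_zero : (0 : Quat).fst = 0 := rfl
@[simp] theorem snd_zero : (0 : Quat).snd = 0 := rfl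
@[simp] theorem fst_add (x y : Quat) : (x + y).fst = x.fst + y.fst := rfl
@[simp] theorem snd_add (x y : Quat) : (x + y).snd = x.snd + y.snd := rfl
@[simp] theorem fst_smul (c : ℂ) (x : Quat) : (c • x).fst = c * x.fst := rfl
@[simp] theorem snd_smul (c : ℂ) (x : Quat) : (c • x).snd = c * x.snd := rfl
@[simp] theorem fst_real_smul (r : ℝ) (x : Quat) : (r • x).fst = (r : ℂ) * x.fst := rfl
@[simp] theorem snd_real_smul (r : ℝ) (x : Quat) : (r • x).snd = (r : ℂ) * x.snd := rfl

/-- The quaternion product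
`(z₁ + j z₂)(w₁ + j w₂) = (z₁ w₁ - z̄₂ w₂) + j (z̄₁ w₂ + z₂ w₁)`. -/
instance : Mul Quat :=
  ⟨fun x y => mk (x.fst * y.fst - conj x.snd * y.snd) (conj x.fst * y.snd + x.snd * y.fst)⟩

instance : One Quat := ⟨mk 1 0⟩

theorem mul_def (x y : Quat) :
    x * y = mk (x.fst * y.fst - conj x.snd * y.snd) (conj x.fst * y.snd + x.snd * y.fst) := rfl

@[simp] theorem fst_one : (1 : Quat).fst = 1 := rfl
@[simp] theorem snd_one : (1 : Quat).snd = 0 := rfl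
@[simp] theorem fst_mul (x y : Quat) :
    (x * y).fst = x.fst * y.fst - conj x.snd * y.snd := rfl
@[simp] theorem snd_mul (x y : Quat) :
    (x * y).snd = conj x.fst * y.snd + x.snd * y.fst := rfl

instance : Ring Quat :=
  { (inferInstance : AddCommGroup Quat) with
    mul := (· * ·)
    one := 1
    mul_assoc := by intro x y z; ext <;> simp <;> ring
    one_mul := by intro x; ext <;> simp
    mul_one := by intro x; ext <;> simp
    left_distrib := by intro x y z; ext <;> simp <;> ring
    right_distrib := by intro x y z; ext <;> simp <;> ring
    zero_mul := by intro x; ext <;> simp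
    mul_zero := by intro x; ext <;> simp }

/-- The quaternions are an associative algebra over the reals (the product is complex linear only
in the right factor). -/
instance : Algebra ℝ Quat :=
  Algebra.ofModule (by intro r x y; ext <;> simp <;> ring) (by intro r x y; ext <;> simp <;> ring)

/-- The quaternion `a + j b` of Mathlib; here `j (c + d i) = c j - d k`. -/
def toQ (x : Quat) : Quaternion ℝ := ⟨x.fst.re, x.fst.im, x.snd.re, -x.snd.im⟩

@[simp] theorem re_toQ (x : Quat) : x.toQ.re = x.fst.re := rfl
@[simp] theorem imI_toQ (x : Quat) : x.toQ.imI = x.fst.im := rfl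
@[simp] theorem imJ_toQ (x : Quat) : x.toQ.imJ = x.snd.re := rfl
@[simp] theorem imK_toQ (x : Quat) : x.toQ.imK = -x.snd.im := rfl

/-- `(a, b) ↦ a + j b` is a ring isomorphism onto Mathlib's quaternions. -/
def toQuaternion : Quat ≃+* Quaternion ℝ where
  toFun := toQ
  invFun q := mk ⟨q.re, q.imI⟩ ⟨q.imJ, -q.imK⟩
  left_inv x := by ext <;> simp
  right_inv q := by ext <;> simp
  map_add' x y := by ext <;> simp; ring
  map_mul' x y := by ext <;> simp <;> ring

end Quat

/-! ### Basis harmonic polynomials and spinors on `ℂ²` -/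

/-- `ℂ²` with its Hermitian norm; the coordinates `z₁, z₂` are `z 0, z 1`. -/
abbrev C2 : Type := EuclideanSpace ℂ (Fin 2)

/-- The Wirtinger derivative `∂/∂zᵢ = (∂/∂xᵢ - √-1 ∂/∂yᵢ) / 2`. -/
def dz (i : Fin 2) (f : C2 → ℂ) : C2 → ℂ := fun z =>
  (1 / 2 : ℂ) * (fderiv ℝ f z (EuclideanSpace.single i 1)
    - Complex.I * fderiv ℝ f z (EuclideanSpace.single i Complex.I))

/-- The Wirtinger derivative `∂/∂z̄ᵢ = (∂/∂xᵢ + √-1 ∂/∂yᵢ) / 2`. -/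
def dzbar (i : Fin 2) (f : C2 → ℂ) : C2 → ℂ := fun z =>
  (1 / 2 : ℂ) * (fderiv ℝ f z (EuclideanSpace.single i 1)
    + Complex.I * fderiv ℝ f z (EuclideanSpace.single i Complex.I))

/-- The vector field `e₋ = - z̄₂ ∂/∂z₁ + z̄₁ ∂/∂z₂`. -/
def eMinus (f : C2 → ℂ) : C2 → ℂ := fun z =>
  -conj (z 1) * dz 0 f z + conj (z 0) * dz 1 f z

/-- The vector field `ê₋ = z̄₂ ∂/∂z̄₁ - z₁ ∂/∂z₂`. -/
def eHatMinus (f : C2 → ℂ) : C2 → ℂ := fun z =>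
  conj (z 1) * dzbar 0 f z - z 0 * dz 1 f z

/-- The harmonic polynomial `v^k_{(a,b)} = (e₋)^k (z₁^a z₂^b)`. -/
def vPoly (k a b : ℕ) : C2 → ℂ := eMinus^[k] (fun z => z 0 ^ a * z 1 ^ b)

/-- The harmonic polynomial `w^k_{(a,b)} = (ê₋)^k (z₂^a z̄₁^b)`. -/
def wPoly (k a b : ℕ) : C2 → ℂ := eHatMinus^[k] (fun z => z 1 ^ a * conj (z 0) ^ b)

/-- The normalising constant `√((m+1-k)! / (k! l! (m-l)!))`, for `l ≤ m` and `k ≤ m + 1`. -/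
def normConst (m l k : ℕ) : ℝ :=
  Real.sqrt ((Nat.factorial (m + 1 - k) : ℝ) /
    (Nat.factorial k * Nat.factorial l * Nat.factorial (m - l)))

/-- The basis spinor `φ^{+(m,l,k)}`, for `l ≤ m` and `k ≤ m + 1`. For `k = 0` the first component
vanishes. -/
def phiPlus (m l k : ℕ) (z : C2) : Quat :=
  (normConst m l k : ℂ) • Quat.mk (k * vPoly (k - 1) l (m - l) z) (-vPoly k l (m - l) z)

/-- The basis spinor `φ^{-(m,l,k)}`, for `l ≤ m`, `k ≤ m + 1` and `z ≠ 0`. -/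
def phiMinus (m l k : ℕ) (z : C2) : Quat :=
  ((normConst m l k * (1 / ‖z‖ ^ 2) ^ (m + 2) : ℝ) : ℂ) •
    Quat.mk (wPoly k (m + 1 - l) l z) (wPoly k (m - l) (l + 1) z)

/-! ### Spinors of Laurent polynomial type and their restriction to the three-sphere -/

/-- `ℂ² \ {0}`. -/
abbrev C2Punctured : Type := {z : C2 // z ≠ 0}

/-- The complex vector space `ℂ[φ^±]` of spinors of Laurent polynomial type on `ℂ² \ {0}`: the finite
complex linear combinations of the `φ^{±(m,l,k)}`, `0 ≤ l ≤ m`, `0 ≤ k ≤ m + 1`. -/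
def LaurentSpinors : Submodule ℂ (C2Punctured → Quat) :=
  Submodule.span ℂ {f | ∃ m l k : ℕ, l ≤ m ∧ k ≤ m + 1 ∧
    ((f = fun z : C2Punctured => phiPlus m l k z) ∨
      (f = fun z : C2Punctured => phiMinus m l k z))}

/-- The unit sphere of `ℂ²`. -/
abbrev S3 : Type := Metric.sphere (0 : C2) 1

instance factFinrankC2 : Fact (Module.finrank ℝ C2 = 3 + 1) :=
  ⟨by rw [← Module.finrank_mul_finrank ℝ ℂ C2]; simp⟩

theorem S3.ne_zero (z : S3) : (z : C2) ≠ 0 := by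
  intro h
  have := z.2
  simp [h] at this

/-- Restriction of spinors from `ℂ² \ {0}` to the three-sphere. -/
def restrictS3 : (C2Punctured → Quat) →ₗ[ℂ] (S3 → Quat) :=
  LinearMap.funLeft ℂ Quat (fun z : S3 => (⟨z, S3.ne_zero z⟩ : C2Punctured))

/-- `ℂ[φ^±]|_{S³}`. -/
def LaurentSpinorsS3 : Submodule ℂ (S3 → Quat) := LaurentSpinors.map restrictS3

/-- `φ^{+(m,l,k)}` restricted to the three-sphere. -/
def phiPlusS3 (m l k : ℕ) : S3 → Quat := restrictS3 (fun z : C2Punctured => phiPlus m l k z)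

/-- `φ^{-(m,l,k)}` restricted to the three-sphere. -/
def phiMinusS3 (m l k : ℕ) : S3 → Quat := restrictS3 (fun z : C2Punctured => phiMinus m l k z)

theorem contMDiff_mul_complex {f g : S3 → ℂ} (hf : ContMDiff (𝓡 3) 𝓘(ℝ, ℂ) ∞ f)
    (hg : ContMDiff (𝓡 3) 𝓘(ℝ, ℂ) ∞ g) :
    ContMDiff (𝓡 3) 𝓘(ℝ, ℂ) ∞ (fun z => f z * g z) :=
  (contDiff_mul (𝕜 := ℝ) (𝔸 := ℂ) (n := ∞)).contMDiff.comp (hf.prodMk_space hg)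

theorem contMDiff_conj_complex {f : S3 → ℂ} (hf : ContMDiff (𝓡 3) 𝓘(ℝ, ℂ) ∞ f) :
    ContMDiff (𝓡 3) 𝓘(ℝ, ℂ) ∞ (fun z => conj (f z)) :=
  (Complex.conjCLE.contDiff (n := ∞)).contMDiff.comp hf

/-- The real algebra `S³H` of smooth maps from the three-sphere to the quaternions (both complex
components are smooth), with pointwise quaternion multiplication. -/
def S3H : Subalgebra ℝ (S3 → Quat) where
  carrier := {f | ContMDiff (𝓡 3) 𝓘(ℝ, ℂ) ∞ (fun z => (f z).fst) ∧
    ContMDiff (𝓡 3) 𝓘(ℝ, ℂ) ∞ (fun z => (f z).snd)}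
  add_mem' := fun hf hg => ⟨hf.1.add hg.1, hf.2.add hg.2⟩
  mul_mem' := fun hf hg =>
    ⟨(contMDiff_mul_complex hf.1 hg.1).sub
        (contMDiff_mul_complex (contMDiff_conj_complex hf.2) hg.2),
      (contMDiff_mul_complex (contMDiff_conj_complex hf.1) hg.2).add
        (contMDiff_mul_complex hf.2 hg.1)⟩
  algebraMap_mem' := fun r => by
    have h : algebraMap ℝ (S3 → Quat) r = fun _ => algebraMap ℝ Quat r := rfl
    rw [h]
    exact ⟨contMDiff_const, contMDiff_const⟩

end

/-! Both the space of restricted spinors and the complex span of products of $I,J,\kappa,\mu$ equal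
one space, `polySpinors`: maps $S^3\to\mathbf H$ whose two components are polynomials in
$z_1,z_2,\bar z_1,\bar z_2$. That space is closed under the product, because conjugation preserves
such polynomials, and it consists of smooth maps.

For the spinors, three facts are used. On $S^3$ every polynomial is a combination of the
$v^k_{(a,b)}$: recurrences involving $|z|^2=1$ make their span stable under multiplication by each
coordinate (`polyS3_mem_vSpanS3`). Each $w$ is a multiple of a $v$, since $\hat e_-$ and $e_-$
commute (`factorial_mul_wMv`). Hence a suitable $\phi^-$ is proportional to $((d+1)v^l,v^{l+1})$
while $\phi^+$ is proportional to $((l+1)v^l,-v^{l+1})$, with the same indices $(a,b)$; adding them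
isolates $(v^l,0)$, and $(0,v^l)$ follows.

For the generators, left multiplication by $J$ exchanges the components up to sign, and sums and
differences of left multiplications by $\kappa$ and $\mu$ multiply a component by any one coordinate
(`spinorFst_polyS3_mem`). -/

noncomputable section


/-! ### Polynomials in the coordinates and their conjugates; vector fields as derivations -/

open MvPolynomial in
/-- The function on `ℂ²` given by a polynomial in `z₁, z₂, z̄₁, z̄₂`. -/
def polyFun (p : MvPolynomial (Fin 4) ℂ) (z : C2) : ℂ :=
  eval ![z 0, z 1, conj (z 0), conj (z 1)] p

section PolyFun

open MvPolynomial

@[simp] theorem polyFun_C (c : ℂ) (z : C2) : polyFun (C c) z = c := by simp [polyFun]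
@[simp] theorem polyFun_zero (z : C2) : polyFun 0 z = 0 := by simp [polyFun]
@[simp] theorem polyFun_one (z : C2) : polyFun 1 z = 1 := by simp [polyFun]
@[simp] theorem polyFun_add (p q : MvPolynomial (Fin 4) ℂ) (z : C2) :
    polyFun (p + q) z = polyFun p z + polyFun q z := by simp [polyFun]
@[simp] theorem polyFun_sub (p q : MvPolynomial (Fin 4) ℂ) (z : C2) :
    polyFun (p - q) z = polyFun p z - polyFun q z := by simp [polyFun]
@[simp] theorem polyFun_neg (p : MvPolynomial (Fin 4) ℂ) (z : C2) :
    polyFun (-p) z = -polyFun p z := by simp [polyFun]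
@[simp] theorem polyFun_mul (p q : MvPolynomial (Fin 4) ℂ) (z : C2) :
    polyFun (p * q) z = polyFun p z * polyFun q z := by simp [polyFun]
@[simp] theorem polyFun_pow (p : MvPolynomial (Fin 4) ℂ) (n : ℕ) (z : C2) :
    polyFun (p ^ n) z = polyFun p z ^ n := by simp [polyFun]
@[simp] theorem polyFun_natCast (n : ℕ) (z : C2) : polyFun (n : MvPolynomial (Fin 4) ℂ) z = n := by
  simp [polyFun]
@[simp] theorem polyFun_X_zero (z : C2) : polyFun (X 0) z = z 0 := by simp [polyFun]
@[simp] theorem polyFun_X_one (z : C2) : polyFun (X 1) z = z 1 := by simp [polyFun]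
@[simp] theorem polyFun_X_two (z : C2) : polyFun (X 2) z = conj (z 0) := by simp [polyFun]
@[simp] theorem polyFun_X_three (z : C2) : polyFun (X 3) z = conj (z 1) := by simp [polyFun]

/-- Conjugation swaps the variables $0\leftrightarrow2$ and $1\leftrightarrow3$. This is needed
because the quaternion product conjugates components of its left factor. -/
theorem exists_polyFun_eq_conj (p : MvPolynomial (Fin 4) ℂ) :
    ∃ q, ∀ z, polyFun q z = conj (polyFun p z) := by
  induction p using MvPolynomial.induction_on with
  | C a => exact ⟨C (conj a), by simp⟩
  | add p q hp hq =>
    obtain ⟨p', hp'⟩ := hp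
    obtain ⟨q', hq'⟩ := hq
    exact ⟨p' + q', by simp [hp', hq']⟩
  | mul_X p i hp =>
    obtain ⟨p', hp'⟩ := hp
    refine ⟨p' * X (![2, 3, 0, 1] i), fun z => ?_⟩
    fin_cases i <;> simp [hp']

/-- The real linear maps `z₁, z₂, z̄₁, z̄₂` on `ℂ²`. -/
def coordCLM : Fin 4 → C2 →L[ℝ] ℂ :=
  let x (i : Fin 2) : C2 →L[ℝ] ℂ := (EuclideanSpace.proj (𝕜 := ℂ) i).restrictScalars ℝ
  ![x 0, x 1, Complex.conjCLE.toContinuousLinearMap.comp (x 0),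
    Complex.conjCLE.toContinuousLinearMap.comp (x 1)]

theorem polyFun_X (i : Fin 4) (z : C2) : polyFun (X i) z = coordCLM i z := by
  fin_cases i <;> simp [polyFun, coordCLM]

/-- The chain rule with $z_i$ and $\bar z_i$ treated as independent variables. It turns Wirtinger
derivatives into formal partial derivatives, so identities for $v$ and $w$ can be proved among
polynomials. -/
theorem hasFDerivAt_polyFun (p : MvPolynomial (Fin 4) ℂ) (z : C2) :
    HasFDerivAt (polyFun p) (∑ i, polyFun (pderiv i p) z • coordCLM i) z := by
  induction p using MvPolynomial.induction_on with
  | C a =>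
    have h : polyFun (C a) = fun _ => a := by ext w; rw [polyFun_C]
    rw [h]
    refine (hasFDerivAt_const (𝕜 := ℝ) a z).congr_fderiv ?_
    ext v
    simp [Fin.sum_univ_four]
  | add p q hp hq =>
    have h : polyFun (p + q) = polyFun p + polyFun q := by ext w; rw [polyFun_add]; rfl
    rw [h]
    refine (hp.add hq).congr_fderiv ?_
    ext v
    simp [Fin.sum_univ_four]
    ring
  | mul_X p j hp =>
    have h : polyFun (p * X j) = polyFun p * coordCLM j := by
      ext w; rw [polyFun_mul, polyFun_X]; rfl
    rw [h]
    refine (hp.mul (coordCLM j).hasFDerivAt).congr_fderiv ?_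
    have hd : ∀ i, polyFun (pderiv i (p * X j)) z
        = polyFun p z * (if i = j then 1 else 0) + coordCLM j z * polyFun (pderiv i p) z := by
      intro i
      by_cases hij : i = j
      · subst hij; simp [polyFun_X, mul_comm]
      · simp [pderiv_X_of_ne (Ne.symm hij), polyFun_X, hij, mul_comm]
    ext v
    simp only [hd]
    fin_cases j <;> simp [Fin.sum_univ_four] <;> ring

theorem dz_zero_polyFun (p : MvPolynomial (Fin 4) ℂ) :
    dz 0 (polyFun p) = polyFun (pderiv 0 p) := by
  ext z
  simp only [dz, (hasFDerivAt_polyFun p z).fderiv]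
  simp [Fin.sum_univ_four, coordCLM]
  ring_nf; simp; ring

theorem dz_one_polyFun (p : MvPolynomial (Fin 4) ℂ) :
    dz 1 (polyFun p) = polyFun (pderiv 1 p) := by
  ext z
  simp only [dz, (hasFDerivAt_polyFun p z).fderiv]
  simp [Fin.sum_univ_four, coordCLM]
  ring_nf; simp; ring

theorem dzbar_zero_polyFun (p : MvPolynomial (Fin 4) ℂ) :
    dzbar 0 (polyFun p) = polyFun (pderiv 2 p) := by
  ext z
  simp only [dzbar, (hasFDerivAt_polyFun p z).fderiv]
  simp [Fin.sum_univ_four, coordCLM]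
  ring_nf; simp; ring

/-- The derivation of polynomials that induces `eMinus`. -/
def eMinusDer : Derivation ℂ (MvPolynomial (Fin 4) ℂ) (MvPolynomial (Fin 4) ℂ) :=
  mkDerivation ℂ ![-X 3, X 2, 0, 0]

/-- The derivation of polynomials that induces `eHatMinus`. -/
def eHatMinusDer : Derivation ℂ (MvPolynomial (Fin 4) ℂ) (MvPolynomial (Fin 4) ℂ) :=
  mkDerivation ℂ ![0, -X 0, X 3, 0]

@[simp] theorem eMinusDer_X_zero : eMinusDer (X 0) = -X 3 := by simp [eMinusDer, mkDerivation_X]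
@[simp] theorem eMinusDer_X_one : eMinusDer (X 1) = X 2 := by simp [eMinusDer, mkDerivation_X]
@[simp] theorem eMinusDer_X_two : eMinusDer (X 2) = 0 := by simp [eMinusDer, mkDerivation_X]
@[simp] theorem eMinusDer_X_three : eMinusDer (X 3) = 0 := by simp [eMinusDer, mkDerivation_X]
@[simp] theorem eHatMinusDer_X_zero : eHatMinusDer (X 0) = 0 := by
  simp [eHatMinusDer, mkDerivation_X]
@[simp] theorem eHatMinusDer_X_one : eHatMinusDer (X 1) = -X 0 := by
  simp [eHatMinusDer, mkDerivation_X]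
@[simp] theorem eHatMinusDer_X_two : eHatMinusDer (X 2) = X 3 := by
  simp [eHatMinusDer, mkDerivation_X]
@[simp] theorem eHatMinusDer_X_three : eHatMinusDer (X 3) = 0 := by
  simp [eHatMinusDer, mkDerivation_X]

theorem eMinusDer_eq (p : MvPolynomial (Fin 4) ℂ) :
    eMinusDer p = -X 3 * pderiv 0 p + X 2 * pderiv 1 p := by
  have h : eMinusDer = (-X 3 : MvPolynomial (Fin 4) ℂ) • pderiv (R := ℂ) (0 : Fin 4)
      + (X 2 : MvPolynomial (Fin 4) ℂ) • pderiv (R := ℂ) (1 : Fin 4) := by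
    refine derivation_ext fun i => ?_
    fin_cases i <;> simp [pderiv_X]
  rw [h]; simp

theorem eHatMinusDer_eq (p : MvPolynomial (Fin 4) ℂ) :
    eHatMinusDer p = X 3 * pderiv 2 p - X 0 * pderiv 1 p := by
  have h : eHatMinusDer = (X 3 : MvPolynomial (Fin 4) ℂ) • pderiv (R := ℂ) (2 : Fin 4)
      - (X 0 : MvPolynomial (Fin 4) ℂ) • pderiv (R := ℂ) (1 : Fin 4) := by
    refine derivation_ext fun i => ?_
    fin_cases i <;> simp [pderiv_X]
  rw [h]; simp

theorem eMinus_polyFun (p : MvPolynomial (Fin 4) ℂ) :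
    eMinus (polyFun p) = polyFun (eMinusDer p) := by
  ext z
  simp [eMinus, dz_zero_polyFun, dz_one_polyFun, eMinusDer_eq]

theorem eHatMinus_polyFun (p : MvPolynomial (Fin 4) ℂ) :
    eHatMinus (polyFun p) = polyFun (eHatMinusDer p) := by
  ext z
  simp [eHatMinus, dzbar_zero_polyFun, dz_one_polyFun, eHatMinusDer_eq]

/-- The polynomial inducing `vPoly`. -/
def vMv (k a b : ℕ) : MvPolynomial (Fin 4) ℂ := eMinusDer^[k] (X 0 ^ a * X 1 ^ b)

/-- The polynomial inducing `wPoly`. -/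
def wMv (k a b : ℕ) : MvPolynomial (Fin 4) ℂ := eHatMinusDer^[k] (X 1 ^ a * X 2 ^ b)

theorem vPoly_eq (k a b : ℕ) : vPoly k a b = polyFun (vMv k a b) := by
  induction k with
  | zero => ext z; simp [vPoly, vMv]
  | succ k ih =>
    rw [vPoly, Function.iterate_succ_apply', ← vPoly, ih, eMinus_polyFun, vMv, vMv,
      Function.iterate_succ_apply']

theorem wPoly_eq (k a b : ℕ) : wPoly k a b = polyFun (wMv k a b) := by
  induction k with
  | zero => ext z; simp [wPoly, wMv]
  | succ k ih =>
    rw [wPoly, Function.iterate_succ_apply', ← wPoly, ih, eHatMinus_polyFun, wMv, wMv,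
      Function.iterate_succ_apply']

end PolyFun

/-! ### Iterated Leibniz rules -/

section Derivation

variable {A : Type*} [CommRing A] [Algebra ℂ A] (D : Derivation ℂ A A)

theorem Derivation.iterate_const_mul {c : A} (hc : D c = 0) (k : ℕ) (f : A) :
    D^[k] (c * f) = c * D^[k] f := by
  induction k with
  | zero => rfl
  | succ k ih => simp [Function.iterate_succ_apply', ih, hc]

/-- The Leibniz expansion stops after two terms. At $k=0$ the truncated exponent $k-1$ is harmless,
as its coefficient vanishes. -/
theorem Derivation.iterate_mul_of_apply_apply_eq_zero {x : A} (hx : D (D x) = 0) (k : ℕ) (f : A) :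
    D^[k] (x * f) = x * D^[k] f + k * D x * D^[k - 1] f := by
  induction k with
  | zero => simp
  | succ k ih =>
    rw [Function.iterate_succ_apply', ih]
    rcases k with _ | k
    · simp [mul_comm]
    · simp only [map_add, D.leibniz, hx, smul_eq_mul, Derivation.map_natCast,
        Nat.add_sub_cancel, Function.iterate_succ_apply']
      push_cast
      ring

theorem Derivation.iterate_add (k : ℕ) (f g : A) : D^[k] (f + g) = D^[k] f + D^[k] g :=
  iterate_map_add D k f g

end Derivation

/-! ### Recurrences for $v$ and the proportionality of $w$ to $v$ -/

section Recurrences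

open MvPolynomial

theorem vMv_succ (k a b : ℕ) : vMv (k + 1) a b = eMinusDer^[k] (eMinusDer (X 0 ^ a * X 1 ^ b)) :=
  Function.iterate_succ_apply _ _ _

theorem vMv_succ_left (k a b : ℕ) :
    vMv k (a + 1) b = X 0 * vMv k a b - (k : MvPolynomial (Fin 4) ℂ) * X 3 * vMv (k - 1) a b := by
  have h := eMinusDer.iterate_mul_of_apply_apply_eq_zero (x := X 0) (by simp) k (X 0 ^ a * X 1 ^ b)
  rw [← mul_assoc, ← pow_succ'] at h
  rw [vMv, h, eMinusDer_X_zero, vMv, vMv]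
  ring

theorem vMv_succ_right (k a b : ℕ) :
    vMv k a (b + 1) = X 1 * vMv k a b + (k : MvPolynomial (Fin 4) ℂ) * X 2 * vMv (k - 1) a b := by
  have h := eMinusDer.iterate_mul_of_apply_apply_eq_zero (x := X 1) (by simp) k (X 0 ^ a * X 1 ^ b)
  rw [show (X 1 : MvPolynomial (Fin 4) ℂ) * (X 0 ^ a * X 1 ^ b) = X 0 ^ a * X 1 ^ (b + 1) by ring]
    at h
  rw [vMv, h, eMinusDer_X_one, vMv, vMv]

/-- Each application of $e_-$ lowers the degree in $z_1,z_2$ by one. -/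
theorem vMv_eq_zero {k a b : ℕ} (h : a + b < k) : vMv k a b = 0 := by
  induction a generalizing k with
  | zero =>
    induction b generalizing k with
    | zero =>
      obtain ⟨k, rfl⟩ := Nat.exists_eq_succ_of_ne_zero h.ne_bot
      rw [Nat.succ_eq_add_one, vMv_succ]
      simp
    | succ b ih => rw [vMv_succ_right, ih (by omega), ih (by omega)]; simp
  | succ a ih => rw [vMv_succ_left, ih (by omega), ih (by omega)]; simp

/-- The polynomial `z₁ z̄₁ + z₂ z̄₂`. -/
def normSqMv : MvPolynomial (Fin 4) ℂ := X 0 * X 2 + X 1 * X 3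

theorem eMinusDer_normSqMv : eMinusDer normSqMv = 0 := by
  simp [normSqMv]; ring

/-- Differentiate once, then replace $z_1\bar z_1$ by $|z|^2-z_2\bar z_2$. The factors $\bar z_2$
and $|z|^2$ are killed by $e_-$, so they pass through the remaining $k$ derivatives. -/
theorem vMv_succ_succ_left (k a b : ℕ) :
    vMv (k + 1) (a + 1) b
      = -(((a + b + 1 : ℕ) : MvPolynomial (Fin 4) ℂ) * X 3) * vMv k a b
        + (b : MvPolynomial (Fin 4) ℂ) * normSqMv * vMv k a (b - 1) := by
  have h : eMinusDer (X 0 ^ (a + 1) * X 1 ^ b)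
      = -(((a + b + 1 : ℕ) : MvPolynomial (Fin 4) ℂ) * X 3) * (X 0 ^ a * X 1 ^ b)
        + (b : MvPolynomial (Fin 4) ℂ) * normSqMv * (X 0 ^ a * X 1 ^ (b - 1)) := by
    rcases b with _ | b
    · simp [Derivation.leibniz_pow]; ring
    · simp [Derivation.leibniz_pow, normSqMv]; ring
  have h1 : eMinusDer (-(((a + b + 1 : ℕ) : MvPolynomial (Fin 4) ℂ) * X 3)) = 0 := by
    rw [map_neg, Derivation.leibniz, Derivation.map_natCast]; simp
  have h2 : eMinusDer ((b : MvPolynomial (Fin 4) ℂ) * normSqMv) = 0 := by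
    simp [eMinusDer_normSqMv]
  rw [vMv_succ, h, Derivation.iterate_add, Derivation.iterate_const_mul _ h1,
    Derivation.iterate_const_mul _ h2, vMv, vMv]

theorem vMv_succ_succ_right (k a b : ℕ) :
    vMv (k + 1) a (b + 1)
      = ((a + b + 1 : ℕ) : MvPolynomial (Fin 4) ℂ) * X 2 * vMv k a b
        - (a : MvPolynomial (Fin 4) ℂ) * normSqMv * vMv k (a - 1) b := by
  have h : eMinusDer (X 0 ^ a * X 1 ^ (b + 1))
      = ((a + b + 1 : ℕ) : MvPolynomial (Fin 4) ℂ) * X 2 * (X 0 ^ a * X 1 ^ b)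
        + -((a : MvPolynomial (Fin 4) ℂ) * normSqMv) * (X 0 ^ (a - 1) * X 1 ^ b) := by
    rcases a with _ | a
    · simp [Derivation.leibniz_pow]; ring
    · simp [Derivation.leibniz_pow, normSqMv]; ring
  have h1 : eMinusDer (((a + b + 1 : ℕ) : MvPolynomial (Fin 4) ℂ) * X 2) = 0 := by
    rw [Derivation.leibniz, Derivation.map_natCast]; simp
  have h2 : eMinusDer (-((a : MvPolynomial (Fin 4) ℂ) * normSqMv)) = 0 := by
    simp [eMinusDer_normSqMv]
  rw [vMv_succ, h, Derivation.iterate_add, Derivation.iterate_const_mul _ h1,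
    Derivation.iterate_const_mul _ h2, neg_mul, ← sub_eq_add_neg, vMv, vMv]

theorem eHatMinusDer_eMinusDer (p : MvPolynomial (Fin 4) ℂ) :
    eHatMinusDer (eMinusDer p) = eMinusDer (eHatMinusDer p) := by
  have h : ⁅eHatMinusDer, eMinusDer⁆ = 0 := by
    refine derivation_ext fun i => ?_
    fin_cases i <;> simp [Derivation.commutator_apply]
  simpa [Derivation.commutator_apply, sub_eq_zero] using congrArg (fun D => D p) h

/-- By commutation $\hat e_-$ may act first on the monomial, where it trades a factor $z_2$ for
$-z_1$. -/
theorem eHatMinusDer_vMv (k a c : ℕ) :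
    eHatMinusDer (vMv k a (c + 1)) = -(((c + 1 : ℕ) : MvPolynomial (Fin 4) ℂ) * vMv k (a + 1) c) := by
  have hc : Function.Commute eHatMinusDer eMinusDer := eHatMinusDer_eMinusDer
  rw [vMv, (hc.iterate_right k).eq, vMv, ← Derivation.iterate_const_mul _ (by simp),
    ← iterate_map_neg]
  congr 1
  simp [Derivation.leibniz_pow]
  ring

/-- With no factor $z_1$ the $|z|^2$ term of the recurrence drops out, so each $e_-$ trades a $z_2$
for a $\bar z_1$. -/
theorem factorial_mul_vMv_zero (a b : ℕ) :
    (a.factorial : MvPolynomial (Fin 4) ℂ) * vMv b 0 (a + b)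
      = ((a + b).factorial : MvPolynomial (Fin 4) ℂ) * (X 1 ^ a * X 2 ^ b) := by
  induction b with
  | zero => simp [vMv]
  | succ b ih =>
    rw [← add_assoc, vMv_succ_succ_right, Nat.factorial_succ]
    push_cast
    linear_combination ((a : MvPolynomial (Fin 4) ℂ) + b + 1) * X 2 * ih

/-- Applying $\hat e_-$ to the identity for $k$ raises $k$ on both sides. The factorials on both
sides avoid division. -/
theorem factorial_mul_wMv {k a b c : ℕ} (h : a + b = k + c) :
    (c.factorial : MvPolynomial (Fin 4) ℂ) * wMv k a b
      = (-1) ^ k * (a.factorial : MvPolynomial (Fin 4) ℂ) * vMv b k c := by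
  induction k generalizing c with
  | zero =>
    obtain rfl : c = a + b := by omega
    rw [pow_zero, one_mul, factorial_mul_vMv_zero, wMv]
    rfl
  | succ k ih =>
    have h1 := congrArg eHatMinusDer (ih (c := c + 1) (by omega))
    have h2 : eHatMinusDer ((-1) ^ k * (a.factorial : MvPolynomial (Fin 4) ℂ)) = 0 := by
      have := eHatMinusDer.map_intCast ((-1) ^ k * (a.factorial : ℤ))
      push_cast at this
      exact this
    have h3 : eHatMinusDer (wMv k a b) = wMv (k + 1) a b :=
      (Function.iterate_succ_apply' _ _ _).symm
    rw [Derivation.leibniz, Derivation.leibniz, eHatMinusDer_vMv, h2, h3, Derivation.map_natCast,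
      Nat.factorial_succ] at h1
    -- Passing from $(c+1)!$ to $c!$ leaves a common factor $c+1$ to cancel.
    have h4 : ((c + 1 : ℕ) : MvPolynomial (Fin 4) ℂ) ≠ 0 := Nat.cast_ne_zero.2 (by omega)
    refine mul_left_cancel₀ h4 ?_
    simp only [smul_eq_mul] at h1
    push_cast at h1 ⊢
    linear_combination h1

end Recurrences

@[simp] theorem Quat.fst_neg (x : Quat) : (-x).fst = -x.fst := rfl
@[simp] theorem Quat.snd_neg (x : Quat) : (-x).snd = -x.snd := rfl

/-! ### Polynomial functions and polynomial spinors on the three-sphere -/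

section Sphere

open MvPolynomial

theorem S3.normSq_eq (z : S3) : z.1 0 * conj (z.1 0) + z.1 1 * conj (z.1 1) = 1 := by
  have h : ‖(z : C2)‖ = 1 := by simp
  have h2 := EuclideanSpace.norm_sq_eq (z : C2)
  rw [h, Fin.sum_univ_two, one_pow] at h2
  rw [Complex.mul_conj, Complex.mul_conj, Complex.normSq_eq_norm_sq, Complex.normSq_eq_norm_sq,
    ← Complex.ofReal_add, ← h2, Complex.ofReal_one]

/-- Polynomials in `z₁, z₂, z̄₁, z̄₂` as functions on the three-sphere. -/
def polyS3 : MvPolynomial (Fin 4) ℂ →ₐ[ℂ] (S3 → ℂ) where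
  toFun p z := polyFun p z
  map_one' := by ext; simp
  map_zero' := by ext; simp
  map_add' p q := by ext; simp
  map_mul' p q := by ext; simp
  commutes' c := by ext; simp [algebraMap_eq]

@[simp] theorem polyS3_apply (p : MvPolynomial (Fin 4) ℂ) (z : S3) : polyS3 p z = polyFun p z := rfl

theorem polyS3_normSqMv : polyS3 normSqMv = 1 := by
  ext z
  simp [normSqMv, S3.normSq_eq]

/-- The span of the harmonic polynomials `v^k_{(a,b)}` on the three-sphere. -/
def vSpanS3 : Submodule ℂ (S3 → ℂ) :=
  Submodule.span ℂ (Set.range fun i : ℕ × ℕ × ℕ => polyS3 (vMv i.1 i.2.1 i.2.2))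

theorem polyS3_vMv_mem (k a b : ℕ) : polyS3 (vMv k a b) ∈ vSpanS3 :=
  Submodule.subset_span ⟨(k, a, b), rfl⟩

theorem natCast_mul_polyS3_vMv_mem (n k a b : ℕ) :
    (n : S3 → ℂ) * polyS3 (vMv k a b) ∈ vSpanS3 := by
  rw [← nsmul_eq_mul]
  exact nsmul_mem (polyS3_vMv_mem k a b) n

theorem mem_vSpanS3_of_natCast_succ_mul_mem {n : ℕ} {f : S3 → ℂ}
    (h : ((n + 1 : ℕ) : S3 → ℂ) * f ∈ vSpanS3) : f ∈ vSpanS3 := by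
  rw [← nsmul_eq_mul, ← Nat.cast_smul_eq_nsmul ℂ] at h
  exact (Submodule.smul_mem_iff _ (Nat.cast_ne_zero.2 n.succ_ne_zero)).1 h

/-- With $|z|^2=1$ the recurrence can be solved for $\bar z_2 v^k_{(a,b)}$, whose coefficient
$a+b+1$ is nonzero. -/
theorem coord_three_mul_vMv_mem (k a b : ℕ) : polyS3 (X 3) * polyS3 (vMv k a b) ∈ vSpanS3 := by
  refine mem_vSpanS3_of_natCast_succ_mul_mem (n := a + b) ?_
  have h := congrArg polyS3 (vMv_succ_succ_left k a b)
  simp only [map_add, map_mul, map_neg, map_natCast, polyS3_normSqMv] at h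
  have h2 : ((a + b + 1 : ℕ) : S3 → ℂ) * (polyS3 (X 3) * polyS3 (vMv k a b))
      = (b : S3 → ℂ) * polyS3 (vMv k a (b - 1)) - polyS3 (vMv (k + 1) (a + 1) b) := by
    linear_combination h
  rw [h2]
  exact sub_mem (natCast_mul_polyS3_vMv_mem _ _ _ _) (polyS3_vMv_mem _ _ _)

theorem coord_two_mul_vMv_mem (k a b : ℕ) : polyS3 (X 2) * polyS3 (vMv k a b) ∈ vSpanS3 := by
  refine mem_vSpanS3_of_natCast_succ_mul_mem (n := a + b) ?_
  have h := congrArg polyS3 (vMv_succ_succ_right k a b)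
  simp only [map_sub, map_mul, map_natCast, polyS3_normSqMv] at h
  have h2 : ((a + b + 1 : ℕ) : S3 → ℂ) * (polyS3 (X 2) * polyS3 (vMv k a b))
      = (a : S3 → ℂ) * polyS3 (vMv k (a - 1) b) + polyS3 (vMv (k + 1) a (b + 1)) := by
    linear_combination -h
  rw [h2]
  exact add_mem (natCast_mul_polyS3_vMv_mem _ _ _ _) (polyS3_vMv_mem _ _ _)

/-- The Leibniz recurrence reduces multiplication by $z_1$ to multiplication by $\bar z_2$. -/
theorem coord_zero_mul_vMv_mem (k a b : ℕ) : polyS3 (X 0) * polyS3 (vMv k a b) ∈ vSpanS3 := by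
  have h := congrArg polyS3 (vMv_succ_left k a b)
  simp only [map_sub, map_mul, map_natCast] at h
  have h2 : polyS3 (X 0) * polyS3 (vMv k a b)
      = polyS3 (vMv k (a + 1) b) + k • (polyS3 (X 3) * polyS3 (vMv (k - 1) a b)) := by
    rw [nsmul_eq_mul]
    linear_combination -h
  rw [h2]
  exact add_mem (polyS3_vMv_mem _ _ _) (nsmul_mem (coord_three_mul_vMv_mem _ _ _) _)

theorem coord_one_mul_vMv_mem (k a b : ℕ) : polyS3 (X 1) * polyS3 (vMv k a b) ∈ vSpanS3 := by
  have h := congrArg polyS3 (vMv_succ_right k a b)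
  simp only [map_add, map_mul, map_natCast] at h
  have h2 : polyS3 (X 1) * polyS3 (vMv k a b)
      = polyS3 (vMv k a (b + 1)) - k • (polyS3 (X 2) * polyS3 (vMv (k - 1) a b)) := by
    rw [nsmul_eq_mul]
    linear_combination -h
  rw [h2]
  exact sub_mem (polyS3_vMv_mem _ _ _) (nsmul_mem (coord_two_mul_vMv_mem _ _ _) _)

theorem coord_mul_mem_vSpanS3 (i : Fin 4) {f : S3 → ℂ} (hf : f ∈ vSpanS3) :
    polyS3 (X i) * f ∈ vSpanS3 := by
  suffices h : vSpanS3 ≤ vSpanS3.comap (LinearMap.mulLeft ℂ (polyS3 (X i))) from h hf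
  refine Submodule.span_le.2 ?_
  rintro _ ⟨⟨k, a, b⟩, rfl⟩
  fin_cases i
  · exact coord_zero_mul_vMv_mem k a b
  · exact coord_one_mul_vMv_mem k a b
  · exact coord_two_mul_vMv_mem k a b
  · exact coord_three_mul_vMv_mem k a b

/-- On the three-sphere every polynomial agrees with a combination of the `v^k_{(a,b)}`. -/
theorem polyS3_mem_vSpanS3 (p : MvPolynomial (Fin 4) ℂ) : polyS3 p ∈ vSpanS3 := by
  induction p using MvPolynomial.induction_on with
  | C c =>
    have h : polyS3 (C c) = c • polyS3 (vMv 0 0 0) := by ext z; simp [vMv]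
    rw [h]
    exact Submodule.smul_mem _ _ (polyS3_vMv_mem _ _ _)
  | add p q hp hq => rw [map_add]; exact add_mem hp hq
  | mul_X p i hp => rw [mul_comm, map_mul]; exact coord_mul_mem_vSpanS3 i hp

/-- Spinors on the three-sphere with vanishing second component. -/
def spinorFst : (S3 → ℂ) →ₗ[ℂ] (S3 → Quat) where
  toFun f z := Quat.mk (f z) 0
  map_add' f g := by ext z <;> simp
  map_smul' c f := by ext z <;> simp

/-- Spinors on the three-sphere with vanishing first component. -/
def spinorSnd : (S3 → ℂ) →ₗ[ℂ] (S3 → Quat) where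
  toFun f z := Quat.mk 0 (f z)
  map_add' f g := by ext z <;> simp
  map_smul' c f := by ext z <;> simp

@[simp] theorem spinorFst_apply (f : S3 → ℂ) (z : S3) : spinorFst f z = Quat.mk (f z) 0 := rfl
@[simp] theorem spinorSnd_apply (f : S3 → ℂ) (z : S3) : spinorSnd f z = Quat.mk 0 (f z) := rfl

/-- The spinors on the three-sphere whose components are polynomials in `z₁, z₂, z̄₁, z̄₂`. -/
def polySpinors : Submodule ℂ (S3 → Quat) where
  carrier := {f | (∃ p, ∀ z : S3, (f z).fst = polyFun p z) ∧ ∃ p, ∀ z : S3, (f z).snd = polyFun p z}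
  zero_mem' := ⟨⟨0, by simp⟩, ⟨0, by simp⟩⟩
  add_mem' := by
    rintro f g ⟨⟨p, hp⟩, ⟨q, hq⟩⟩ ⟨⟨p', hp'⟩, ⟨q', hq'⟩⟩
    exact ⟨⟨p + p', by simp [hp, hp']⟩, ⟨q + q', by simp [hq, hq']⟩⟩
  smul_mem' := by
    rintro c f ⟨⟨p, hp⟩, ⟨q, hq⟩⟩
    exact ⟨⟨C c * p, by simp [hp]⟩, ⟨C c * q, by simp [hq]⟩⟩

theorem mul_mem_polySpinors {f g : S3 → Quat} (hf : f ∈ polySpinors) (hg : g ∈ polySpinors) :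
    f * g ∈ polySpinors := by
  obtain ⟨⟨p, hp⟩, ⟨q, hq⟩⟩ := hf
  obtain ⟨⟨p', hp'⟩, ⟨q', hq'⟩⟩ := hg
  obtain ⟨r, hr⟩ := exists_polyFun_eq_conj p
  obtain ⟨s, hs⟩ := exists_polyFun_eq_conj q
  exact ⟨⟨p * p' - s * q', by simp [hp, hq, hp', hq', hs]⟩,
    ⟨r * q' + q * p', by simp [hp, hq, hp', hq', hr]⟩⟩

theorem polySpinors_le {N : Submodule ℂ (S3 → Quat)} (h₁ : ∀ p, spinorFst (polyS3 p) ∈ N)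
    (h₂ : ∀ p, spinorSnd (polyS3 p) ∈ N) : polySpinors ≤ N := by
  rintro f ⟨⟨p, hp⟩, ⟨q, hq⟩⟩
  have h : f = spinorFst (polyS3 p) + spinorSnd (polyS3 q) := by ext z <;> simp [hp, hq]
  rw [h]
  exact add_mem (h₁ p) (h₂ q)

theorem contMDiff_polyFun (p : MvPolynomial (Fin 4) ℂ) :
    ContMDiff (𝓡 3) 𝓘(ℝ, ℂ) ∞ (fun z : S3 => polyFun p z) := by
  induction p using MvPolynomial.induction_on with
  | C c => simpa using contMDiff_const
  | add p q hp hq =>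
    simp only [polyFun_add]
    exact hp.add hq
  | mul_X p i hp =>
    simp only [polyFun_mul, polyFun_X]
    exact contMDiff_mul_complex hp ((coordCLM i).contDiff.contMDiff.comp contMDiff_coe_sphere)

theorem polySpinors_subset_S3H {f : S3 → Quat} (hf : f ∈ polySpinors) : f ∈ S3H := by
  obtain ⟨⟨p, hp⟩, ⟨q, hq⟩⟩ := hf
  constructor
  · simpa only [hp] using contMDiff_polyFun p
  · simpa only [hq] using contMDiff_polyFun q

end Sphere

/-! ### The restricted spinors are exactly the polynomial spinors -/

section Spinors

open MvPolynomial

theorem normConst_ne_zero (m l k : ℕ) : (normConst m l k : ℂ) ≠ 0 := by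
  rw [Complex.ofReal_ne_zero, normConst]
  exact (Real.sqrt_pos.2 (by positivity)).ne'

theorem phiPlusS3_apply (m l k : ℕ) (z : S3) : phiPlusS3 m l k z = (normConst m l k : ℂ) •
    Quat.mk (k * polyFun (vMv (k - 1) l (m - l)) z) (-polyFun (vMv k l (m - l)) z) := by
  rw [← vPoly_eq, ← vPoly_eq]
  rfl

theorem phiMinusS3_apply (m l k : ℕ) (z : S3) : phiMinusS3 m l k z = (normConst m l k : ℂ) •
    Quat.mk (polyFun (wMv k (m + 1 - l) l) z) (polyFun (wMv k (m - l) (l + 1)) z) := by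
  have h : ‖(z : C2)‖ = 1 := by simp
  rw [← wPoly_eq, ← wPoly_eq]
  change phiMinus m l k z = _
  rw [phiMinus, h]
  simp

theorem LaurentSpinorsS3_eq_span : LaurentSpinorsS3 =
    Submodule.span ℂ {f | ∃ m l k : ℕ, l ≤ m ∧ k ≤ m + 1 ∧
      (f = phiPlusS3 m l k ∨ f = phiMinusS3 m l k)} := by
  rw [LaurentSpinorsS3, LaurentSpinors, Submodule.map_span]
  congr 1
  ext f
  constructor
  · rintro ⟨_, ⟨m, l, k, hl, hk, rfl | rfl⟩, rfl⟩
    · exact ⟨m, l, k, hl, hk, Or.inl rfl⟩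
    · exact ⟨m, l, k, hl, hk, Or.inr rfl⟩
  · rintro ⟨m, l, k, hl, hk, rfl | rfl⟩
    · exact ⟨_, ⟨m, l, k, hl, hk, Or.inl rfl⟩, rfl⟩
    · exact ⟨_, ⟨m, l, k, hl, hk, Or.inr rfl⟩, rfl⟩

theorem phiPlusS3_mem {m l k : ℕ} (hl : l ≤ m) (hk : k ≤ m + 1) :
    phiPlusS3 m l k ∈ LaurentSpinorsS3 := by
  rw [LaurentSpinorsS3_eq_span]
  exact Submodule.subset_span ⟨m, l, k, hl, hk, Or.inl rfl⟩

theorem phiMinusS3_mem {m l k : ℕ} (hl : l ≤ m) (hk : k ≤ m + 1) :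
    phiMinusS3 m l k ∈ LaurentSpinorsS3 := by
  rw [LaurentSpinorsS3_eq_span]
  exact Submodule.subset_span ⟨m, l, k, hl, hk, Or.inr rfl⟩

theorem phiPlusS3_mem_polySpinors (m l k : ℕ) : phiPlusS3 m l k ∈ polySpinors :=
  ⟨⟨C (normConst m l k : ℂ) * ((k : MvPolynomial (Fin 4) ℂ) * vMv (k - 1) l (m - l)), by simp [phiPlusS3_apply]⟩,
    ⟨C (normConst m l k : ℂ) * -vMv k l (m - l), by simp [phiPlusS3_apply]⟩⟩

theorem phiMinusS3_mem_polySpinors (m l k : ℕ) : phiMinusS3 m l k ∈ polySpinors :=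
  ⟨⟨C (normConst m l k : ℂ) * wMv k (m + 1 - l) l, by simp [phiMinusS3_apply]⟩,
    ⟨C (normConst m l k : ℂ) * wMv k (m - l) (l + 1), by simp [phiMinusS3_apply]⟩⟩

theorem LaurentSpinorsS3_le_polySpinors : LaurentSpinorsS3 ≤ polySpinors := by
  rw [LaurentSpinorsS3_eq_span, Submodule.span_le]
  rintro _ ⟨m, l, k, -, -, rfl | rfl⟩
  · exact phiPlusS3_mem_polySpinors m l k
  · exact phiMinusS3_mem_polySpinors m l k

theorem nsmul_spinorFst_sub_spinorSnd_mem {k a b : ℕ} (h : k ≤ a + b + 1) :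
    (k : ℂ) • spinorFst (polyS3 (vMv (k - 1) a b)) - spinorSnd (polyS3 (vMv k a b))
      ∈ LaurentSpinorsS3 := by
  have h1 : phiPlusS3 (a + b) a k ∈ LaurentSpinorsS3 := phiPlusS3_mem (by omega) h
  rw [← Submodule.smul_mem_iff _ (normConst_ne_zero (a + b) a k)]
  convert h1 using 1
  ext z <;> simp [phiPlusS3_apply, sub_eq_add_neg]

/-- The components $w^a_{(d+1,l)}$ and $w^a_{(d,l+1)}$ of $\phi^{-(l+d,l,a)}$ convert to
$v^l_{(a,b)}$ and $v^{l+1}_{(a,b)}$ with the same $b$; the coefficient $d+1$ is $(d+1)!/d!$. -/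
theorem nsmul_spinorFst_add_spinorSnd_mem {l d a b : ℕ} (h : l + d + 1 = a + b) :
    ((d + 1 : ℕ) : ℂ) • spinorFst (polyS3 (vMv l a b)) + spinorSnd (polyS3 (vMv (l + 1) a b))
      ∈ LaurentSpinorsS3 := by
  have h1 : phiMinusS3 (l + d) l a ∈ LaurentSpinorsS3 := phiMinusS3_mem (by omega) (by omega)
  have hc : (normConst (l + d) l a : ℂ) * ((-1) ^ a * (d.factorial : ℂ)) ≠ 0 :=
    mul_ne_zero (normConst_ne_zero _ _ _)
      (mul_ne_zero (by simp) (Nat.cast_ne_zero.2 d.factorial_ne_zero))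
  rw [← Submodule.smul_mem_iff _ hc]
  convert Submodule.smul_mem _ (b.factorial : ℂ) h1 using 1
  have e1 := factorial_mul_wMv (k := a) (a := d + 1) (b := l) (c := b) (by omega)
  have e2 := factorial_mul_wMv (k := a) (a := d) (b := l + 1) (c := b) (by omega)
  ext z
  · have e := congrArg (fun p => polyFun p z) e1
    simp [Nat.factorial_succ] at e
    simp [phiMinusS3_apply, show l + d + 1 - l = d + 1 by omega]
    linear_combination -(normConst (l + d) l a : ℂ) * e
  · have e := congrArg (fun p => polyFun p z) e2
    simp at e
    simp [phiMinusS3_apply]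
    linear_combination -(normConst (l + d) l a : ℂ) * e

theorem spinorFst_vMv_mem (l a b : ℕ) : spinorFst (polyS3 (vMv l a b)) ∈ LaurentSpinorsS3 := by
  rcases lt_or_ge (a + b) l with hl | hl
  · simp [vMv_eq_zero hl]
  have h1 := nsmul_spinorFst_sub_spinorSnd_mem (k := l + 1) (a := a) (b := b) (by omega)
  rw [Nat.add_sub_cancel] at h1
  rcases hl.eq_or_lt with hl | hl
  -- For $l=a+b$ the second component of $\phi^+$ already vanishes.
  · rw [vMv_eq_zero (k := l + 1) (by omega), map_zero, map_zero, sub_zero] at h1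
    exact (Submodule.smul_mem_iff _ (Nat.cast_ne_zero.2 l.succ_ne_zero)).1 h1
  · obtain ⟨d, hd⟩ := Nat.exists_eq_add_of_lt hl
    -- The second components cancel, leaving $(l+1)+(d+1)=a+b+1$ times the wanted spinor.
    have h2 := add_mem h1 (nsmul_spinorFst_add_spinorSnd_mem hd.symm)
    rw [sub_add_add_cancel, ← add_smul, ← Nat.cast_add] at h2
    exact (Submodule.smul_mem_iff _ (Nat.cast_ne_zero.2 (by omega))).1 h2

theorem spinorSnd_vMv_mem (l a b : ℕ) : spinorSnd (polyS3 (vMv l a b)) ∈ LaurentSpinorsS3 := by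
  rcases lt_or_ge (a + b) l with hl | hl
  · simp [vMv_eq_zero hl]
  have h1 := nsmul_spinorFst_sub_spinorSnd_mem (k := l) (a := a) (b := b) (by omega)
  simpa using sub_mem (Submodule.smul_mem _ (l : ℂ) (spinorFst_vMv_mem (l - 1) a b)) h1

theorem LaurentSpinorsS3_eq_polySpinors : LaurentSpinorsS3 = polySpinors := by
  refine le_antisymm LaurentSpinorsS3_le_polySpinors (polySpinors_le (fun p => ?_) fun p => ?_)
  · suffices h : vSpanS3 ≤ LaurentSpinorsS3.comap spinorFst from h (polyS3_mem_vSpanS3 p)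
    refine Submodule.span_le.2 ?_
    rintro _ ⟨i, rfl⟩
    exact spinorFst_vMv_mem _ _ _
  · suffices h : vSpanS3 ≤ LaurentSpinorsS3.comap spinorSnd from h (polyS3_mem_vSpanS3 p)
    refine Submodule.span_le.2 ?_
    rintro _ ⟨i, rfl⟩
    exact spinorSnd_vMv_mem _ _ _

end Spinors

/-! ### Generation by $I,J,\kappa,\mu$ -/

section Generators

open MvPolynomial

theorem phiPlusS3_zero_zero_one (z : S3) : phiPlusS3 0 0 1 z = Quat.mk 1 0 := by
  ext <;> simp [phiPlusS3_apply, vMv, normConst]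

theorem phiPlusS3_zero_zero_zero (z : S3) : phiPlusS3 0 0 0 z = Quat.mk 0 (-1) := by
  ext <;> simp [phiPlusS3_apply, vMv, normConst]

theorem phiPlusS3_one_zero_one (z : S3) :
    phiPlusS3 1 0 1 z = Quat.mk (z.1 1) (-conj (z.1 0)) := by
  ext <;> simp [phiPlusS3_apply, vMv, normConst]

theorem phiMinusS3_zero_zero_zero (z : S3) :
    phiMinusS3 0 0 0 z = Quat.mk (z.1 1) (conj (z.1 0)) := by
  ext <;> simp [phiMinusS3_apply, wMv, normConst]

/-- The complex span of the products of the four generators. -/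
def generatedSpinors : Submodule ℂ (S3 → Quat) :=
  Submodule.span ℂ (Subsemigroup.closure
    {phiPlusS3 0 0 1, phiPlusS3 0 0 0, phiPlusS3 1 0 1, phiMinusS3 0 0 0} : Set (S3 → Quat))

theorem generatedSpinors_le_polySpinors : generatedSpinors ≤ polySpinors := by
  refine Submodule.span_le.2 fun f hf => ?_
  induction hf using Subsemigroup.closure_induction with
  | mem f hf =>
    rcases hf with rfl | rfl | rfl | rfl
    · exact phiPlusS3_mem_polySpinors _ _ _
    · exact phiPlusS3_mem_polySpinors _ _ _
    · exact phiPlusS3_mem_polySpinors _ _ _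
    · exact phiMinusS3_mem_polySpinors _ _ _
  | mul f g _ _ hf hg => exact mul_mem_polySpinors hf hg

/-- Only left multiplication is used: the product is complex linear in its right factor but not in
its left one. -/
theorem generator_mul_mem {g f : S3 → Quat}
    (hg : g ∈ ({phiPlusS3 0 0 1, phiPlusS3 0 0 0, phiPlusS3 1 0 1, phiMinusS3 0 0 0} :
      Set (S3 → Quat)))
    (hf : f ∈ generatedSpinors) : g * f ∈ generatedSpinors := by
  induction hf using Submodule.span_induction with
  | mem f hf =>
    exact Submodule.subset_span (Subsemigroup.mul_mem _ (Subsemigroup.subset_closure hg) hf)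
  | zero => simp
  | add f₁ f₂ _ _ h₁ h₂ => rw [mul_add]; exact add_mem h₁ h₂
  | smul c f _ h =>
    have e : g * c • f = c • (g * f) := by ext z <;> simp <;> ring
    rw [e]
    exact Submodule.smul_mem _ c h

theorem spinorFst_mem_of_spinorSnd_mem {f : S3 → ℂ} (hf : spinorSnd f ∈ generatedSpinors) :
    spinorFst f ∈ generatedSpinors := by
  have h := generator_mul_mem (g := phiPlusS3 0 0 0) (by simp) hf
  convert h using 1
  ext z <;> simp [phiPlusS3_zero_zero_zero]

theorem spinorSnd_mem_of_spinorFst_mem {f : S3 → ℂ} (hf : spinorFst f ∈ generatedSpinors) :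
    spinorSnd f ∈ generatedSpinors := by
  have h := neg_mem (generator_mul_mem (g := phiPlusS3 0 0 0) (by simp) hf)
  have e : spinorSnd f = -(phiPlusS3 0 0 0 * spinorFst f) := by
    rw [eq_neg_iff_add_eq_zero]
    ext z <;> simp [phiPlusS3_zero_zero_zero]
  rwa [e]

theorem spinorFst_polyS3_mem (p : MvPolynomial (Fin 4) ℂ) :
    spinorFst (polyS3 p) ∈ generatedSpinors := by
  induction p using MvPolynomial.induction_on with
  | C c =>
    have e : spinorFst (polyS3 (C c)) = c • phiPlusS3 0 0 1 := by
      ext z <;> simp [phiPlusS3_zero_zero_one]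
    rw [e]
    exact Submodule.smul_mem _ c
      (Submodule.subset_span (Subsemigroup.subset_closure (by simp)))
  | add p q hp hq => rw [map_add, map_add]; exact add_mem hp hq
  | mul_X p i hp =>
    have hp' := spinorSnd_mem_of_spinorFst_mem hp
    have h2 : (2 : ℂ) ≠ 0 := two_ne_zero
    -- On $(p,0)$, $\kappa$ and $\mu$ give $(z_2p,\mp\bar z_1p)$; on $(0,p)$ they give $(\pm
    -- z_1p,\bar z_2p)$. Sums and differences isolate twice each coordinate multiple.
    have k1 := generator_mul_mem (g := phiPlusS3 1 0 1) (by simp) hp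
    have m1 := generator_mul_mem (g := phiMinusS3 0 0 0) (by simp) hp
    have k2 := generator_mul_mem (g := phiPlusS3 1 0 1) (by simp) hp'
    have m2 := generator_mul_mem (g := phiMinusS3 0 0 0) (by simp) hp'
    fin_cases i
    · rw [← Submodule.smul_mem_iff _ h2]
      convert add_mem k2 (Submodule.smul_mem _ (-1 : ℂ) m2) using 1
      ext z <;> simp [phiPlusS3_one_zero_one, phiMinusS3_zero_zero_zero] <;> ring
    · rw [← Submodule.smul_mem_iff _ h2]
      convert add_mem k1 m1 using 1
      ext z <;> simp [phiPlusS3_one_zero_one, phiMinusS3_zero_zero_zero] <;> ring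
    -- The conjugate coordinates appear in the second component, and $J$ moves them to the first.
    · apply spinorFst_mem_of_spinorSnd_mem
      rw [← Submodule.smul_mem_iff _ h2]
      convert add_mem m1 (Submodule.smul_mem _ (-1 : ℂ) k1) using 1
      ext z <;> simp [phiPlusS3_one_zero_one, phiMinusS3_zero_zero_zero] <;> ring
    · apply spinorFst_mem_of_spinorSnd_mem
      rw [← Submodule.smul_mem_iff _ h2]
      convert add_mem k2 m2 using 1
      ext z <;> simp [phiPlusS3_one_zero_one, phiMinusS3_zero_zero_zero] <;> ring

theorem generatedSpinors_eq_polySpinors : generatedSpinors = polySpinors :=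
  le_antisymm generatedSpinors_le_polySpinors <| polySpinors_le spinorFst_polyS3_mem
    fun p => spinorSnd_mem_of_spinorFst_mem (spinorFst_polyS3_mem p)

end Generators

/-- The polynomial spinors as a real subalgebra. -/
def polySpinorAlgebra : Subalgebra ℝ (S3 → Quat) where
  carrier := polySpinors
  add_mem' := add_mem
  mul_mem' := mul_mem_polySpinors
  algebraMap_mem' r := by
    have h : algebraMap ℝ (S3 → Quat) r = (r : ℂ) • phiPlusS3 0 0 1 := by
      rw [Algebra.algebraMap_eq_smul_one]
      ext z <;> simp [phiPlusS3_zero_zero_one]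
    rw [h]
    exact Submodule.smul_mem _ _ (phiPlusS3_mem_polySpinors _ _ _)

end

theorem mainTheorem5 :
    -- `ℂ[φ^±]|_{S³}` is closed under pointwise quaternion multiplication
    (∀ φ ∈ LaurentSpinorsS3, ∀ ψ ∈ LaurentSpinorsS3, φ * ψ ∈ LaurentSpinorsS3) ∧
    -- it is an associative subalgebra of `S³H`
    (∃ A : Subalgebra ℝ (S3 → Quat), A ≤ S3H ∧ (A : Set (S3 → Quat)) = LaurentSpinorsS3) ∧
    -- the four spinors `I, J, κ, μ` are given on `S³` by the stated formulas
    (∀ z : S3,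
      phiPlusS3 0 0 1 z = Quat.mk 1 0 ∧
      phiPlusS3 0 0 0 z = Quat.mk 0 (-1) ∧
      phiPlusS3 1 0 1 z = Quat.mk (z.1 1) (-(starRingEnd ℂ) (z.1 0)) ∧
      phiMinusS3 0 0 0 z = Quat.mk (z.1 1) ((starRingEnd ℂ) (z.1 0))) ∧
    -- they generate: its elements are exactly the complex linear combinations of finite products
    LaurentSpinorsS3 = Submodule.span ℂ
      (Subsemigroup.closure
        {phiPlusS3 0 0 1, phiPlusS3 0 0 0, phiPlusS3 1 0 1, phiMinusS3 0 0 0} :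
          Set (S3 → Quat)) := by
  refine ⟨fun φ hφ ψ hψ => ?_, ⟨polySpinorAlgebra, fun f hf => polySpinors_subset_S3H hf, ?_⟩,
    fun z => ⟨phiPlusS3_zero_zero_one z, phiPlusS3_zero_zero_zero z, phiPlusS3_one_zero_one z,
      phiMinusS3_zero_zero_zero z⟩, ?_⟩
  · rw [LaurentSpinorsS3_eq_polySpinors] at *
    exact mul_mem_polySpinors hφ hψ
  · rw [LaurentSpinorsS3_eq_polySpinors]
    rfl
  · rw [LaurentSpinorsS3_eq_polySpinors, ← generatedSpinors_eq_polySpinors]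
    rfl
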